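/- Let $\varepsilon>0$ be a constant. There are a deterministic Turing machine $A$ and an integer $N$ (both depending only on $\varepsilon$) such that the following holds. For every $n\in\mathbb{N}$, on input $1^n$ (the string of $n$ ones) the machine $A$ halts, within a number of steps bounded by a fixed polynomial in $n$, and outputs the $n\times n$ adjacency matrix (written row by row) of an undirected simple graph $H_n$ on $n$ vertices; and for every $n\ge N$, every clique and every independent set of $H_n$ has strictly fewer than $$2^{\varepsilon\sqrt{\log n}\,\log\log n}$$ vertices, where $\log$ denotes the logarithm to base $2$. -/

import Mathlib

open Classical in
/-- The `0`-`1` adjacency matrix of a graph on the vertex set `{0, …, n - 1}`, with Boolean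
entries: the entry at `(i, j)` is `true` iff `i` and `j` are adjacent. -/
noncomputable def boolAdjMatrix {n : ℕ} (G : SimpleGraph (Fin n)) : Matrix (Fin n) (Fin n) Bool :=
  Matrix.of fun i j => decide (G.Adj i j)

/-- A Boolean `n × n` matrix written out as a string of `n * n` bits, row after row, where `n` is
the first component of the argument. -/
def matrixBits (A : (n : ℕ) × Matrix (Fin n) (Fin n) Bool) : List Bool :=
  (List.finRange A.1).flatMap fun i => (List.finRange A.1).map fun j => A.2 i j

/-- There is a deterministic polynomial-time Turing machine that, for every `n`, on input `1ⁿ`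
(the string of `n` ones) halts with exactly the adjacency matrix of `H n`, row by row, as output.
The number of steps is bounded by a polynomial in the input length `n`. -/
def PolyTimeOutputsAdjMatrix (H : (n : ℕ) → SimpleGraph (Fin n)) : Prop :=
  Nonempty (Turing.TM2ComputableInPolyTime Computability.unaryEncodeNat matrixBits
    fun n => (⟨n, boolAdjMatrix (H n)⟩ : (n : ℕ) × Matrix (Fin n) (Fin n) Bool))

/-! Take `q = 2 ^ k` and read each vertex as a word of `q ^ 2 - 1` digits in base `q`. Two vertices
are adjacent when their number of agreeing positions is not `-1` modulo `q`; a word agrees with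
itself in `q ^ 2 - 1 ≡ -1` positions. Words become subsets of a universe of size `(q ^ 2 - 1) q`
(pairs of position and digit), and agreements become intersection sizes.

Both bounds are rank arguments (`card_le_of_orthogonal`). For a clique, work modulo 2: by Lucas,
`a.choose (q - 1)` is odd exactly when `a ≡ -1` modulo `q`, so it separates the diagonal from all
other pairs. For an independent set, work over the rationals: distinct words agree in one of only `q
- 1` possible numbers of positions, and the product of the corresponding linear factors vanishes off
the diagonal. Either way the size is at most `q ^ (3 (q - 1))`.

With `q` the least power of two that provides enough words, `log n` has order at least `q ^ 2 log
q`, while the logarithm of the bound has order `q log q`. The latter is smaller than `sqrt (log n) *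
log log n` by a factor of order `sqrt (log log n)`, which beats every `ε`.

For the machine, arithmetic is done on unary counters, each counter being a stack. Values and
running times then stay polynomial as long as no large power of `q` is ever formed. -/

namespace CounterProgram

/-! ### Counter programs and their simulation by stack machines -/

open Turing

/-- Programs over counters indexed by `ℕ`, with an additional output string.  `loop v p` runs
`dec v; p` as long as the counter `v` is nonzero; `emit v` prepends to the output the bit telling
whether the counter `v` is nonzero. -/
inductive Prog : Type
  | skip : Prog
  | inc (v : ℕ) : Prog
  | dec (v : ℕ) : Prog
  | emit (v : ℕ) : Prog
  | seq (p q : Prog) : Prog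
  | loop (v : ℕ) (p : Prog) : Prog

/-- The memory of a counter program. -/
@[ext]
structure Mem where
  reg : ℕ → ℕ
  out : List Bool

/-- Overwrite the counter `v`. -/
def Mem.set (s : Mem) (v x : ℕ) : Mem := ⟨Function.update s.reg v x, s.out⟩

/-- `Exec p s s' t`: started in `s`, the program `p` terminates in `s'` after `t` steps. -/
inductive Exec : Prog → Mem → Mem → ℕ → Prop
  | skip (s : Mem) : Exec .skip s s 1
  | inc (s : Mem) (v : ℕ) : Exec (.inc v) s (s.set v (s.reg v + 1)) 1
  | dec (s : Mem) (v : ℕ) : Exec (.dec v) s (s.set v (s.reg v - 1)) 1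
  | emit (s : Mem) (v : ℕ) : Exec (.emit v) s ⟨s.reg, decide (s.reg v ≠ 0) :: s.out⟩ 1
  | seq {p q : Prog} {s s' s'' : Mem} {t t' : ℕ} (h : Exec p s s' t) (h' : Exec q s' s'' t') :
      Exec (.seq p q) s s'' (t + t')
  | loop_zero {s : Mem} {v : ℕ} (p : Prog) (h : s.reg v = 0) : Exec (.loop v p) s s 1
  | loop_succ {p : Prog} {s s' s'' : Mem} {v k t t' : ℕ} (hv : s.reg v = k + 1)
      (h : Exec p (s.set v k) s' t) (h' : Exec (.loop v p) s' s'' t') :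
      Exec (.loop v p) s s'' (1 + t + t')

/-- A strict upper bound for the counters a program mentions. -/
def Prog.bound : Prog → ℕ
  | .skip => 0
  | .inc v => v + 1
  | .dec v => v + 1
  | .emit v => v + 1
  | .seq p q => max p.bound q.bound
  | .loop v p => max (v + 1) p.bound

/-- The control points of a program. -/
def Label : Prog → Type
  | .seq p q => Label p ⊕ Label q
  | .loop _ p => Option (Label p)
  | _ => Unit

noncomputable instance Label.fintype : (p : Prog) → Fintype (Label p)
  | .skip => inferInstanceAs (Fintype Unit)
  | .inc _ => inferInstanceAs (Fintype Unit)
  | .dec _ => inferInstanceAs (Fintype Unit)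
  | .emit _ => inferInstanceAs (Fintype Unit)
  | .seq p q =>
    letI := Label.fintype p
    letI := Label.fintype q
    inferInstanceAs (Fintype (Label p ⊕ Label q))
  | .loop _ p =>
    letI := Label.fintype p
    inferInstanceAs (Fintype (Option (Label p)))

/-- The control point at which a program starts. -/
def entry : (p : Prog) → Label p
  | .skip => ()
  | .inc _ => ()
  | .dec _ => ()
  | .emit _ => ()
  | .seq p _ => Sum.inl (entry p)
  | .loop _ _ => none

/-- The stacks of the machine: one output stack and `R + 1` counters, all over the alphabet
`Bool`. -/
abbrev Stacks (R : ℕ) : Option (Fin (R + 1)) → Type := fun _ => Bool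

/-- The translation of a program into stack machine statements.  `e` embeds the control points of
the program into those of the machine, and `x` is where to continue at the end. -/
def code (R : ℕ) : (p : Prog) → {Λ : Type} → (Label p → Λ) → Λ → Label p →
    TM2.Stmt (Stacks R) Λ Bool
  | .skip, _, _, x, _ => .goto fun _ => x
  | .inc v, _, _, x, _ => .push (some (Fin.ofNat _ v)) (fun _ => true) (.goto fun _ => x)
  | .dec v, _, _, x, _ => .pop (some (Fin.ofNat _ v)) (fun b _ => b) (.goto fun _ => x)
  | .emit v, _, _, x, _ =>
    .peek (some (Fin.ofNat _ v)) (fun _ o => o.isSome)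
      (.push none id (.load (fun _ => false) (.goto fun _ => x)))
  | .seq p _, _, e, _, Sum.inl l => code R p (e ∘ Sum.inl) (e (Sum.inr (entry _))) l
  | .seq _ q, _, e, x, Sum.inr l => code R q (e ∘ Sum.inr) x l
  | .loop v p, _, e, x, none =>
    .pop (some (Fin.ofNat _ v)) (fun _ o => o.isSome)
      (.branch id (.load (fun _ => false) (.goto fun _ => e (some (entry p))))
        (.load (fun _ => false) (.goto fun _ => x)))
  | .loop _ p, _, e, _, some l => code R p (e ∘ some) (e none) l

/-- The stacks representing a memory. -/
def Mem.stk (R : ℕ) (s : Mem) : ∀ k, List (Stacks R k)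
  | none => s.out
  | some r => List.replicate (s.reg r) true

/-- The configuration of the machine at a given control point with a given memory. -/
def cfg (R : ℕ) {Λ : Type} (l : Λ) (s : Mem) : TM2.Cfg (Stacks R) Λ Bool :=
  ⟨some l, false, s.stk R⟩

/-- `t` steps lead from `c` to `c'`. -/
def StepsTo {σ : Type*} (f : σ → Option σ) (t : ℕ) (c c' : σ) : Prop :=
  (flip bind f)^[t] (some c) = some c'

theorem StepsTo.trans {σ : Type*} {f : σ → Option σ} {t t' : ℕ} {a b c : σ}
    (h : StepsTo f t a b) (h' : StepsTo f t' b c) : StepsTo f (t + t') a c := by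
  unfold StepsTo at *
  rw [add_comm, Function.iterate_add_apply, h, h']

theorem StepsTo.single {σ : Type*} {f : σ → Option σ} {a b : σ} (h : f a = some b) :
    StepsTo f 1 a b := h

/-- `Fin.ofNat` reduces modulo `R + 1`; the bound on `v` rules out aliasing between counters. -/
theorem update_stk {R : ℕ} (s : Mem) {v : ℕ} (hv : v < R + 1) (x : ℕ) :
    Function.update (s.stk R) (some (Fin.ofNat (R + 1) v)) (List.replicate x true) =
      (s.set v x).stk R := by
  funext k
  rcases k with _ | r
  · rfl
  · by_cases h : r = Fin.ofNat (R + 1) v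
    · subst h
      simp [Mem.stk, Mem.set, Nat.mod_eq_of_lt hv]
    · have h' : (r : ℕ) ≠ v := by
        rintro rfl
        exact h (by ext; simp)
      rw [Function.update_of_ne (by simpa using h)]
      simp [Mem.stk, Mem.set, Function.update_of_ne h']

theorem stk_some {R : ℕ} (s : Mem) {v : ℕ} (hv : v < R + 1) :
    s.stk R (some (Fin.ofNat (R + 1) v)) = List.replicate (s.reg v) true := by
  simp [Mem.stk, Nat.mod_eq_of_lt hv]

/-- A machine that contains the code of a program simulates it. -/
theorem Exec.stepsTo {R : ℕ} {p : Prog} {s s' : Mem} {t : ℕ} (h : Exec p s s' t)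
    (hR : p.bound ≤ R + 1) {Λ : Type} (M : Λ → TM2.Stmt (Stacks R) Λ Bool) (e : Label p → Λ)
    (x : Λ) (hM : ∀ l, M (e l) = code R p e x l) :
    StepsTo (TM2.step M) t (cfg R (e (entry p)) s) (cfg R x s') := by
  induction h generalizing x with
  | skip s =>
    apply StepsTo.single
    simp [cfg, hM, code]
  | inc s v =>
    apply StepsTo.single
    simp only [cfg, TM2.step, hM, code, TM2.stepAux]
    rw [stk_some s hR, ← List.replicate_succ, update_stk s hR]
  | dec s v =>
    apply StepsTo.single
    simp only [cfg, TM2.step, hM, code, TM2.stepAux]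
    rw [stk_some s hR, List.tail_replicate, update_stk s hR]
  | emit s v =>
    apply StepsTo.single
    simp only [cfg, TM2.step, hM, code, TM2.stepAux]
    rw [stk_some s hR]
    congr 2
    funext k
    rcases k with _ | r
    · rcases h : s.reg v with _ | n <;> simp [Mem.stk, List.replicate_succ]
    · simp [Mem.stk]
  | seq h h' ih ih' =>
    have hR' := max_le_iff.1 hR
    exact (ih hR'.1 (e ∘ Sum.inl) _ fun l => hM _).trans (ih' hR'.2 (e ∘ Sum.inr) x fun l => hM _)
  | @loop_zero s v p h =>
    have hR' := max_le_iff.1 hR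
    apply StepsTo.single
    have hm : M (e (entry (.loop v p))) = .pop (some (Fin.ofNat _ v)) (fun _ o => o.isSome)
      (.branch id (.load (fun _ => false) (.goto fun _ => e (some (entry p))))
        (.load (fun _ => false) (.goto fun _ => x))) := hM _
    simp only [cfg, TM2.step, hm, TM2.stepAux]
    -- The loop test pops even when the counter is zero; popping an empty stack changes nothing.
    have h2 := update_stk s hR'.1 0
    rw [stk_some s hR'.1, h]
    have h3 : s.set v 0 = s := by
      ext1
      · simp [Mem.set, ← h]
      · rfl
    rw [h3] at h2
    simpa using h2
  | @loop_succ p s s' s'' v k t t' hv h h' ih ih' =>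
    have hR' := max_le_iff.1 hR
    refine (StepsTo.trans (b := cfg R (e (some (entry p))) (s.set v k)) ?_
      (ih hR'.2 (e ∘ some) (e none) fun l => hM _)).trans (ih' hR e x hM)
    apply StepsTo.single
    have hm : M (e (entry (.loop v p))) = .pop (some (Fin.ofNat _ v)) (fun _ o => o.isSome)
      (.branch id (.load (fun _ => false) (.goto fun _ => e (some (entry p))))
        (.load (fun _ => false) (.goto fun _ => x))) := hM _
    simp only [cfg, TM2.step, hm, TM2.stepAux]
    rw [stk_some s hR'.1, hv, List.tail_replicate, ← update_stk s hR'.1]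
    simp [List.replicate_succ]

/-- The machine running a program, with input in counter `0`. -/
noncomputable def machine (p : Prog) : FinTM2 where
  K := Option (Fin (p.bound + 1))
  k₀ := some 0
  k₁ := none
  Γ := Stacks p.bound
  Λ := Option (Label p)
  main := some (entry p)
  σ := Bool
  initialState := false
  Γk₀Fin := inferInstanceAs (Fintype Bool)
  m
    | none => .halt
    | some l => code p.bound p some none l

/-- `haltList` requires every stack except the output to be empty, hence the final memory with all
counters zero. The extra step executes `halt`. -/
theorem machine_outputs {p : Prog} {n t : ℕ} {out : List Bool}
    (h : Exec p ⟨Function.update 0 0 n, []⟩ ⟨0, out⟩ t) :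
    Nonempty (TM2OutputsInTime (machine p) (List.replicate n true) (some out) (t + 1)) := by
  have key := h.stepsTo (R := p.bound) (Nat.le_succ _) (machine p).m some none fun l => rfl
  have fin : StepsTo (TM2.step (machine p).m) 1 (cfg p.bound none ⟨0, out⟩)
      ⟨none, false, Mem.stk p.bound ⟨0, out⟩⟩ := rfl
  have h0 : initList (machine p) (List.replicate n true) =
      cfg p.bound (some (entry p)) ⟨Function.update 0 0 n, []⟩ := by
    unfold initList cfg
    congr 1
    funext k
    rcases k with _ | r
    · rfl
    · by_cases hr : r = 0
      · subst hr
        rfl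
      · have h1 : (r : ℕ) ≠ 0 := by simpa using hr
        have h2 : (some r : Option (Fin (p.bound + 1))) ≠ some 0 := by simpa using hr
        simp only [Mem.stk, Function.update_of_ne h1]
        exact dif_neg h2
  have h1 : haltList (machine p) out = ⟨none, false, Mem.stk p.bound ⟨0, out⟩⟩ := by
    unfold haltList
    congr 1
    funext k
    rcases k with _ | r
    · rfl
    · rfl
  refine ⟨⟨⟨t + 1, ?_⟩, le_rfl⟩⟩
  exact (congrArg (fun c => (flip bind (machine p).step)^[t + 1] (some c)) h0).trans
    (Eq.trans (key.trans fin) (congrArg some h1.symm))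


/-! ### Polynomial bounds and timed execution -/

/-- Functions bounded by a polynomial. -/
def PolyBounded (T : ℕ → ℕ) : Prop := ∃ c, ∀ B, T B ≤ (B + 2) ^ c

namespace PolyBounded

theorem mono {T T' : ℕ → ℕ} (h : PolyBounded T) (h' : ∀ B, T' B ≤ T B) : PolyBounded T' :=
  h.imp fun _ hc B => (h' B).trans (hc B)

theorem id : PolyBounded fun B => B := ⟨1, fun B => by simp⟩

theorem const (k : ℕ) : PolyBounded fun _ => k :=
  ⟨k, fun B => Nat.lt_two_pow_self.le.trans (Nat.pow_le_pow_left (by omega) _)⟩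

theorem mul {T T' : ℕ → ℕ} (h : PolyBounded T) (h' : PolyBounded T') :
    PolyBounded fun B => T B * T' B := by
  obtain ⟨c, hc⟩ := h
  obtain ⟨c', hc'⟩ := h'
  exact ⟨c + c', fun B => by rw [pow_add]; exact Nat.mul_le_mul (hc B) (hc' B)⟩

theorem add {T T' : ℕ → ℕ} (h : PolyBounded T) (h' : PolyBounded T') :
    PolyBounded fun B => T B + T' B := by
  obtain ⟨c, hc⟩ := h
  obtain ⟨c', hc'⟩ := h'
  refine ⟨max c c' + 1, fun B => ?_⟩
  have h1 := (hc B).trans (Nat.pow_le_pow_right (by omega) (le_max_left c c'))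
  have h2 := (hc' B).trans (Nat.pow_le_pow_right (by omega) (le_max_right c c'))
  rw [pow_succ]
  nlinarith

theorem comp {T T' : ℕ → ℕ} (h : PolyBounded T) (h' : PolyBounded T') :
    PolyBounded fun B => T (T' B) := by
  obtain ⟨c, hc⟩ := h
  obtain ⟨c', hc'⟩ := h'.add (const 2)
  exact ⟨c' * c, fun B => (hc _).trans (by rw [pow_mul]; exact Nat.pow_le_pow_left (hc' B) _)⟩

end PolyBounded

/-- Execution within a time bound. -/
def Runs (p : Prog) (s s' : Mem) (T : ℕ) : Prop := ∃ t ≤ T, Exec p s s' t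

namespace Runs

theorem mono {p : Prog} {s s' : Mem} {T T' : ℕ} (h : Runs p s s' T) (hT : T ≤ T') :
    Runs p s s' T' :=
  h.imp fun _ ht => ⟨ht.1.trans hT, ht.2⟩

theorem seq {p q : Prog} {s s' s'' : Mem} {T T' : ℕ} (h : Runs p s s' T) (h' : Runs q s' s'' T') :
    Runs (.seq p q) s s'' (T + T') := by
  obtain ⟨t, ht, h⟩ := h
  obtain ⟨t', ht', h'⟩ := h'
  exact ⟨t + t', add_le_add ht ht', h.seq h'⟩

theorem inc (s : Mem) (v : ℕ) : Runs (.inc v) s (s.set v (s.reg v + 1)) 1 :=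
  ⟨1, le_rfl, .inc s v⟩

theorem dec (s : Mem) (v : ℕ) : Runs (.dec v) s (s.set v (s.reg v - 1)) 1 :=
  ⟨1, le_rfl, .dec s v⟩

theorem skip (s : Mem) : Runs .skip s s 1 :=
  ⟨1, le_rfl, .skip s⟩

end Runs

/-- `downFold f n a` applies `f (n - 1)`, `f (n - 2)`, …, `f 0` in this order to `a`. -/
def downFold {α : Type*} (f : ℕ → α → α) : ℕ → α → α
  | 0, a => a
  | n + 1, a => downFold f n (f n a)

/-- The Hoare rule for loops: `st k a` is the memory with loop counter `k` and accumulator `a`. The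
body sees the counter already decremented, so the indices run from `n - 1` down to `0`. -/
theorem Runs.loop {α : Type*} {v : ℕ} {p : Prog} {n T : ℕ} (st : ℕ → α → Mem) (f : ℕ → α → α)
    (Inv : ℕ → α → Prop) (hv : ∀ k a, (st k a).reg v = k)
    (hp : ∀ k a, k < n → Inv (k + 1) a →
      Inv k (f k a) ∧ Runs p ((st (k + 1) a).set v k) (st k (f k a)) T) (a : α) (ha : Inv n a) :
    Runs (.loop v p) (st n a) (st 0 (downFold f n a)) ((T + 1) * n + 1) := by
  induction n generalizing a with
  | zero => exact ⟨1, by simp, .loop_zero p (hv 0 a)⟩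
  | succ n ih =>
    obtain ⟨h1, t, ht, h2⟩ := hp n a n.lt_succ_self ha
    obtain ⟨t', ht', h3⟩ := ih (fun k a hk => hp k a (hk.trans n.lt_succ_self)) _ h1
    exact ⟨1 + t + t', by nlinarith, .loop_succ (hv _ a) h2 h3⟩

theorem downFold_const {α : Type*} (f : α → α) (n : ℕ) (a : α) :
    downFold (fun _ => f) n a = f^[n] a := by
  induction n generalizing a with
  | zero => rfl
  | succ n ih => exact ih _

theorem iterate_add_one (n a : ℕ) : (fun a => a + 1)^[n] a = a + n := by
  induction n generalizing a with
  | zero => rfl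
  | succ n ih => rw [Function.iterate_succ_apply, ih, Nat.add_right_comm, Nat.add_assoc]

theorem Mem.set_eq_self {s : Mem} {v x : ℕ} (h : s.reg v = x) : s.set v x = s := by
  subst h
  simp [Mem.set]

theorem Runs.clear (s : Mem) (v : ℕ) : Runs (.loop v .skip) s (s.set v 0) (2 * s.reg v + 1) := by
  have := Runs.loop (v := v) (n := s.reg v) (T := 1) (p := .skip) (fun k (_ : Unit) => s.set v k)
    (fun _ _ => ()) (fun _ _ => True) (by simp [Mem.set])
    (fun k a _ _ => ⟨trivial, by simpa [Mem.set] using Runs.skip (s.set v k)⟩) () trivial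
  simpa [Mem.set] using this

theorem Runs.move (s : Mem) {v w : ℕ} (h : v ≠ w) :
    Runs (.loop v (.inc w)) s ((s.set w (s.reg w + s.reg v)).set v 0) (2 * s.reg v + 1) := by
  have := Runs.loop (v := v) (n := s.reg v) (T := 1) (p := .inc w) (fun k a => (s.set w a).set v k)
    (fun _ a => a + 1) (fun _ _ => True) (by simp [Mem.set])
    (fun k a _ _ => ⟨trivial, by
      convert Runs.inc (((s.set w a).set v (k + 1)).set v k) w using 1
      simp [Mem.set, h.symm, Function.update_comm h]⟩) (s.reg w) trivial
  rw [downFold_const, iterate_add_one] at this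
  simpa [Mem.set, h, Function.update_comm h] using this

/-- Overwrite the counter `w` by the counter `v`, and clear `v`. -/
def Prog.shift (v w : ℕ) : Prog := .seq (.loop w .skip) (.loop v (.inc w))

theorem Runs.shift (s : Mem) {v w : ℕ} (h : v ≠ w) :
    Runs (.shift v w) s ((s.set w (s.reg v)).set v 0) (2 * s.reg w + 2 * s.reg v + 2) := by
  have := (Runs.clear s w).seq (Runs.move (s.set w 0) h)
  simp only [Mem.set, Function.update_self, Function.update_of_ne h, zero_add,
    Function.update_idem] at this
  exact this.mono (by omega)

/-- Add the counter `v` to `w`, using the auxiliary counter `x`. -/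
def Prog.copy (v w x : ℕ) : Prog := .seq (.loop v (.seq (.inc w) (.inc x))) (.loop x (.inc v))

theorem Runs.copy (s : Mem) {v w x : ℕ} (hvw : v ≠ w) (hvx : v ≠ x) (hwx : w ≠ x)
    (hx : s.reg x = 0) :
    Runs (.copy v w x) s (s.set w (s.reg w + s.reg v)) (5 * s.reg v + 2) := by
  have h1 := Runs.loop (v := v) (n := s.reg v) (T := 2) (p := .seq (.inc w) (.inc x))
    (fun k a => ((s.set w (s.reg w + a)).set x a).set v k)
    (fun _ a => a + 1) (fun _ _ => True) (by simp [Mem.set])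
    (fun k a _ _ => ⟨trivial, by
      convert (Runs.inc ((((s.set w (s.reg w + a)).set x a).set v (k + 1)).set v k) w).seq
        (Runs.inc _ x) using 1
      ext r
      · simp only [Mem.set, Function.update_apply]
        split_ifs <;> omega
      · rfl⟩) 0 trivial
  rw [downFold_const, iterate_add_one, zero_add] at h1
  have h2 := h1.seq (Runs.move _ hvx.symm)
  refine Eq.mp ?_ (h2.mono (T' := 5 * s.reg v + 2) ?_)
  · congr 1
    · ext r
      · simp only [Mem.set, Function.update_apply]
        split_ifs <;> first | omega | simp_all
      · rfl
    · ext r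
      · simp only [Mem.set, Function.update_apply]
        split_ifs <;> first | omega | simp_all
      · rfl
  · simp only [Mem.set, Function.update_apply, hvx.symm, if_true, if_false]
    omega

/-! ### Polynomial-time computable functions: composition and bounded recursion -/

/-- The program `p` computes `f`, reading the arguments from the counters `ρ i`, writing the
result into the counter `d`, and using the counters above `d` as scratch space, in time `T B` for
arguments at most `B`. -/
def ComputesAt {ι : Type} (f : (ι → ℕ) → ℕ) (ρ : ι → ℕ) (d : ℕ) (p : Prog) (T : ℕ → ℕ) : Prop :=
  ∀ (s : Mem) (B : ℕ), (∀ r, d ≤ r → s.reg r = 0) → (∀ i, s.reg (ρ i) ≤ B) →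
    Runs p s (s.set d (f fun i => s.reg (ρ i))) (T B)

/-- Functions of natural numbers that are bounded by a polynomial and that a counter program
computes in polynomial time. -/
structure PolyComputable {ι : Type} (f : (ι → ℕ) → ℕ) : Prop where
  bounded : ∃ b, PolyBounded b ∧ ∀ B e, (∀ i, e i ≤ B) → f e ≤ b B
  computes : ∀ (ρ : ι → ℕ) (d : ℕ), (∀ i, ρ i < d) → ∃ p T, PolyBounded T ∧ ComputesAt f ρ d p T

namespace PolyComputable

variable {ι κ : Type}

theorem proj (i : ι) : PolyComputable fun e => e i where
  bounded := ⟨_, .id, fun _ _ h => h i⟩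
  computes ρ d hρ := by
    refine ⟨.copy (ρ i) d (d + 1), fun B => 5 * B + 2, ((PolyBounded.const 5).mul .id).add (.const 2),
      fun s B hs hB => ?_⟩
    have := Runs.copy s (v := ρ i) (w := d) (x := d + 1) (hρ i).ne (by have := hρ i; omega)
      (by omega) (hs _ (by omega))
    rw [hs d le_rfl, zero_add] at this
    exact this.mono (Nat.add_le_add_right (Nat.mul_le_mul_left 5 (hB i)) 2)

theorem succ {f : (ι → ℕ) → ℕ} (hf : PolyComputable f) : PolyComputable fun e => f e + 1 where
  bounded := by
    obtain ⟨b, hb, h⟩ := hf.bounded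
    exact ⟨_, hb.add (.const 1), fun B e he => Nat.add_le_add_right (h B e he) 1⟩
  computes ρ d hρ := by
    obtain ⟨p, T, hT, h⟩ := hf.computes ρ d hρ
    refine ⟨.seq p (.inc d), _, hT.add (.const 1), fun s B hs hB => ?_⟩
    simpa [Mem.set] using (h s B hs hB).seq (Runs.inc _ d)

theorem pred {f : (ι → ℕ) → ℕ} (hf : PolyComputable f) : PolyComputable fun e => f e - 1 where
  bounded := by
    obtain ⟨b, hb, h⟩ := hf.bounded
    exact ⟨_, hb, fun B e he => (Nat.sub_le _ _).trans (h B e he)⟩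
  computes ρ d hρ := by
    obtain ⟨p, T, hT, h⟩ := hf.computes ρ d hρ
    refine ⟨.seq p (.dec d), _, hT.add (.const 1), fun s B hs hB => ?_⟩
    simpa [Mem.set] using (h s B hs hB).seq (Runs.dec _ d)

theorem const (k : ℕ) : PolyComputable fun _ : ι → ℕ => k := by
  induction k with
  | zero =>
    refine ⟨⟨_, .const 0, fun _ _ _ => le_rfl⟩, fun ρ d hρ => ⟨.skip, _, .const 1, fun s B hs hB => ?_⟩⟩
    convert Runs.skip s using 1
    exact Mem.set_eq_self (hs d le_rfl)
  | succ k ih => exact ih.succ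

theorem rename {f : (ι → ℕ) → ℕ} (hf : PolyComputable f) (σ : ι → κ) :
    PolyComputable fun e : κ → ℕ => f fun i => e (σ i) where
  bounded := by
    obtain ⟨b, hb, h⟩ := hf.bounded
    exact ⟨b, hb, fun B e he => h B _ fun i => he _⟩
  computes ρ d hρ := by
    obtain ⟨p, T, hT, h⟩ := hf.computes (fun i => ρ (σ i)) d fun i => hρ _
    exact ⟨p, T, hT, fun s B hs hB => h s B hs fun i => hB _⟩

/-- The value of `g` is put into `d`, `f` is evaluated into `d + 1`, and the result is shifted back
to `d`. The size bound on `g` controls the running time of `f`. -/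
theorem bind {g : (ι → ℕ) → ℕ} {f : (Option ι → ℕ) → ℕ} (hg : PolyComputable g)
    (hf : PolyComputable f) : PolyComputable fun e => f fun o => o.elim (g e) e := by
  obtain ⟨bg, hbg, hg1⟩ := hg.bounded
  obtain ⟨bf, hbf, hf1⟩ := hf.bounded
  have hb' : PolyBounded fun B => B + bg B := PolyBounded.id.add hbg
  have hle : ∀ B e, (∀ i, e i ≤ B) → ∀ o : Option ι, o.elim (g e) e ≤ B + bg B := by
    rintro B e he (_ | i)
    · exact (hg1 B e he).trans (Nat.le_add_left _ _)
    · exact (he i).trans (Nat.le_add_right _ _)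
  refine ⟨⟨_, hbf.comp hb', fun B e he => hf1 _ _ (hle B e he)⟩, fun ρ d hρ => ?_⟩
  obtain ⟨p, T, hT, h⟩ := hg.computes ρ d hρ
  obtain ⟨q, T', hT', h'⟩ := hf.computes (fun o => o.elim d ρ) (d + 1) (by
    rintro (_ | i)
    · exact d.lt_succ_self
    · exact (hρ i).trans d.lt_succ_self)
  refine ⟨.seq (.seq p q) (.shift (d + 1) d), _,
    (hT.add (hT'.comp hb')).add ((((PolyBounded.const 2).mul hbg).add
      ((PolyBounded.const 2).mul (hbf.comp hb'))).add (.const 2)), fun s B hs hB => ?_⟩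
  have hne : ∀ i, ρ i ≠ d := fun i => (hρ i).ne
  have e1 : (fun o : Option ι => (s.set d (g fun i => s.reg (ρ i))).reg (o.elim d ρ)) =
      fun o => o.elim (g fun i => s.reg (ρ i)) fun i => s.reg (ρ i) := by
    funext o
    rcases o with _ | i <;> simp [Mem.set, hne]
  have r1 := h s B hs hB
  have r2 := h' (s.set d (g fun i => s.reg (ρ i))) (B + bg B)
    (fun r hr => by
      simp only [Mem.set]
      rw [Function.update_of_ne (by omega)]
      exact hs r (by omega))
    (fun o => by
      rw [congrFun e1 o]
      exact hle B _ hB o)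
  rw [e1] at r2
  have r3 := (r1.seq r2).seq (Runs.shift _ d.succ_ne_self)
  refine Eq.mp ?_ (r3.mono (T' := T B + T' (B + bg B) + (2 * bg B + 2 * bf (B + bg B) + 2)) ?_)
  · congr 1
    ext r
    · have := hs (d + 1) (by omega)
      simp only [Mem.set, Function.update_apply]
      split_ifs <;> simp_all
    · rfl
  · have h1 := hg1 B _ hB
    have h2 := hf1 _ _ (hle B _ hB)
    simp only [Mem.set, Function.update_apply, if_true, d.succ_ne_self.symm, if_false]
    omega

/-- Iterating a polynomially bounded step can grow exponentially, so `Inv` has to supply one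
polynomial bound valid for every intermediate accumulator. The accumulator lives in `d`, the loop
counter in `d + 1`, and the result of the body in `d + 2`. -/
theorem fold {n init : (ι → ℕ) → ℕ} {f : (ι → ℕ) → ℕ → ℕ → ℕ} (hn : PolyComputable n)
    (hinit : PolyComputable init)
    (hf : PolyComputable fun e : Option (Option ι) → ℕ =>
      f (fun i => e (some (some i))) (e none) (e (some none)))
    (Inv : (ι → ℕ) → ℕ → ℕ → Prop) (h0 : ∀ e, Inv e (n e) (init e))
    (hInv : ∀ e k a, k < n e → Inv e (k + 1) a → Inv e k (f e k a)) {b : ℕ → ℕ} (hb : PolyBounded b)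
    (hle : ∀ B e, (∀ i, e i ≤ B) → ∀ k a, k ≤ n e → Inv e k a → a ≤ b B) :
    PolyComputable fun e => downFold (f e) (n e) (init e) := by
  have hres : ∀ e k a, k ≤ n e → Inv e k a → Inv e 0 (downFold (f e) k a) := by
    intro e k
    induction k with
    | zero => exact fun a _ h => h
    | succ k ih => exact fun a hk h => ih _ (by omega) (hInv e k a (by omega) h)
  refine ⟨⟨b, hb, fun B e he => hle B e he 0 _ (Nat.zero_le _) (hres e _ _ le_rfl (h0 e))⟩, fun ρ d hρ => ?_⟩
  obtain ⟨bn, hbn, hn1⟩ := hn.bounded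
  obtain ⟨pn, Tn, hTn, hpn⟩ := hn.computes ρ (d + 1) fun i => (hρ i).trans d.lt_succ_self
  obtain ⟨p0, T0, hT0, hp0⟩ := hinit.computes ρ d hρ
  obtain ⟨p, T, hT, hp⟩ := hf.computes (fun o => o.elim (d + 1) fun o => o.elim d ρ) (d + 2) (by
    rintro (_ | _ | i)
    · exact (d + 1).lt_succ_self
    · show d < d + 2
      omega
    · exact (hρ i).trans (by omega))
  have hb' : PolyBounded fun B => B + bn B + b B := (PolyBounded.id.add hbn).add hb
  refine ⟨.seq (.seq p0 pn) (.loop (d + 1) (.seq p (.shift (d + 2) d))), _,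
    (hT0.add hTn).add ((((((hT.comp hb').add ((PolyBounded.const 4).mul hb)).add (.const 2)).add
      (.const 1)).mul hbn).add (.const 1)), fun s B hs hB => ?_⟩
  set e : ι → ℕ := fun i => s.reg (ρ i) with he
  have hne : ∀ i, ρ i ≠ d := fun i => (hρ i).ne
  have hne' : ∀ i, ρ i ≠ d + 1 := fun i => ((hρ i).trans d.lt_succ_self).ne
  have r0 := hp0 s B hs hB
  have e1 : (fun i => (s.set d (init e)).reg (ρ i)) = e := by
    funext i
    simp [Mem.set, hne, he]
  have r1 := hpn (s.set d (init e)) B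
    (fun r hr => by
      simp only [Mem.set]
      rw [Function.update_of_ne (by omega)]
      exact hs r (by omega))
    (fun i => by
      rw [congrFun e1 i]
      exact hB i)
  rw [e1] at r1
  have r2 := Runs.loop (n := n e) (v := d + 1) (p := .seq p (.shift (d + 2) d))
    (T := T (B + bn B + b B) + 4 * b B + 2)
    (fun k a => (s.set d a).set (d + 1) k) (f e) (Inv e) (by simp [Mem.set])
    (fun k a hk ha => ⟨hInv e k a hk ha, by
      have e2 : (fun o : Option (Option ι) => ((s.set d a).set (d + 1) k).reg
          (o.elim (d + 1) fun o => o.elim d ρ)) = fun o => o.elim k fun o => o.elim a e := by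
        funext o
        rcases o with _ | _ | i
        · simp [Mem.set]
        · simp [Mem.set]
        · simp [Mem.set, hne, hne', he]
      have q1 := hp ((s.set d a).set (d + 1) k) (B + bn B + b B)
        (fun r hr => by
          simp only [Mem.set]
          rw [Function.update_of_ne (by omega), Function.update_of_ne (by omega)]
          exact hs r (by omega))
        (fun o => by
          rw [congrFun e2 o]
          have h1 := hn1 B e hB
          have h2 := hle B e hB (k + 1) a hk ha
          rcases o with _ | _ | i
          · show k ≤ _
            omega
          · show a ≤ _
            omega
          · exact (hB i).trans (by omega))
      have e3 : ((s.set d a).set (d + 1) (k + 1)).set (d + 1) k = (s.set d a).set (d + 1) k := by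
        simp [Mem.set]
      rw [e3]
      have q2 := q1.seq (Runs.shift _ (show d + 2 ≠ d by omega))
      have e4 := congrArg (fun u : Option (Option ι) → ℕ =>
        f (fun i => u (some (some i))) (u none) (u (some none))) e2
      simp only [Option.elim] at e4
      refine Eq.mp ?_ (q2.mono (T' := T (B + bn B + b B) + 4 * b B + 2) ?_)
      · congr 1
        ext r
        · have := hs (d + 2) (by omega)
          simp only [Option.elim, e4]
          simp only [Mem.set, Function.update_apply]
          split_ifs <;> first | omega | simp_all
        · rfl
      · simp only [Option.elim, e4]
        have h1 := hle B e hB (k + 1) a hk ha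
        have h2 : f (fun i => e i) k a ≤ b B := hle B e hB k _ hk.le (hInv e k a hk ha)
        simp only [Mem.set, Function.update_apply]
        simp
        omega⟩) (init e) (h0 e)
  have r3 := (r0.seq r1).seq r2
  refine Eq.mp ?_ (r3.mono (T' := T0 B + Tn B + ((T (B + bn B + b B) + 4 * b B + 2 + 1) * bn B + 1)) ?_)
  · congr 1
    ext r
    · have := hs (d + 1) (by omega)
      simp only [Mem.set, Function.update_apply]
      split_ifs <;> first | omega | simp_all
    · rfl
  · have := hn1 B e hB
    gcongr

end PolyComputable


/-! ### Arithmetic in polynomial time -/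

namespace PolyComputable

variable {ι : Type}

theorem congr {f g : (ι → ℕ) → ℕ} (hf : PolyComputable f) (h : ∀ e, g e = f e) :
    PolyComputable g := by
  rwa [show g = f from funext h]

theorem comp₂ {F : ℕ → ℕ → ℕ} (hF : PolyComputable fun e : Fin 2 → ℕ => F (e 0) (e 1))
    {f g : (ι → ℕ) → ℕ} (hf : PolyComputable f) (hg : PolyComputable g) :
    PolyComputable fun e => F (f e) (g e) :=
  hf.bind ((hg.rename some).bind (hF.rename ![some none, none]))

theorem comp₃ {F : ℕ → ℕ → ℕ → ℕ}
    (hF : PolyComputable fun e : Fin 3 → ℕ => F (e 0) (e 1) (e 2))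
    {f g h : (ι → ℕ) → ℕ} (hf : PolyComputable f) (hg : PolyComputable g)
    (hh : PolyComputable h) : PolyComputable fun e => F (f e) (g e) (h e) :=
  hf.bind ((hg.rename some).bind (((hh.rename some).rename some).bind
    (hF.rename ![some (some none), some none, none])))

theorem add {f g : (ι → ℕ) → ℕ} (hf : PolyComputable f) (hg : PolyComputable g) :
    PolyComputable fun e => f e + g e := by
  refine comp₂ (F := fun a b => a + b) ?_ hf hg
  refine (fold (n := fun e => e 1) (f := fun _ _ a => a + 1) (proj 1) (proj 0)
    (proj (some none)).succ (fun e k a => a + k = e 0 + e 1) (fun e => rfl)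
    (fun e k a _ h => by omega) (PolyBounded.id.add .id)
    (fun B e he k a _ h => ?_)).congr fun e => ?_
  · have := he 0
    have := he 1
    omega
  · rw [downFold_const, iterate_add_one]

theorem sub {f g : (ι → ℕ) → ℕ} (hf : PolyComputable f) (hg : PolyComputable g) :
    PolyComputable fun e => f e - g e := by
  refine comp₂ (F := fun a b => a - b) ?_ hf hg
  refine (fold (n := fun e => e 1) (f := fun _ _ a => a - 1) (proj 1) (proj 0)
    (proj (some none)).pred (fun e _ a => a ≤ e 0) (fun e => le_rfl)
    (fun e k a _ h => by omega) PolyBounded.id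
    (fun B e he k a _ h => h.trans (he 0))).congr fun e => ?_
  rw [downFold_const]
  generalize e 0 = a
  induction e 1 generalizing a with
  | zero => rfl
  | succ n ih =>
    rw [Function.iterate_succ_apply, ← ih]
    omega

theorem downFold_add (g : ℕ → ℕ) (n a : ℕ) :
    downFold (fun t a => a + g t) n a = a + ∑ t ∈ Finset.range n, g t := by
  induction n generalizing a with
  | zero => rfl
  | succ n ih =>
    rw [Finset.sum_range_succ, add_comm _ (g n), ← add_assoc]
    exact ih _

theorem sum {n : (ι → ℕ) → ℕ} {g : (ι → ℕ) → ℕ → ℕ} (hn : PolyComputable n)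
    (hg : PolyComputable fun e : Option ι → ℕ => g (fun i => e (some i)) (e none)) :
    PolyComputable fun e => ∑ t ∈ Finset.range (n e), g e t := by
  obtain ⟨bn, hbn, hn1⟩ := hn.bounded
  obtain ⟨bg, hbg, hg1⟩ := hg.bounded
  refine (fold (f := fun e t a => a + g e t) hn (const 0)
    ((proj (some none)).add (hg.rename fun o => o.elim none fun i => some (some i)))
    (fun e k a => a = ∑ t ∈ Finset.Ico k (n e), g e t) (fun e => by simp) ?_
    (hbn.mul (hbg.comp (PolyBounded.id.add hbn))) ?_).congr fun e => ?_
  · rintro e k a hk rfl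
    rw [Finset.sum_eq_sum_Ico_succ_bot hk, add_comm]
  · rintro B e he k a hk rfl
    have h1 : ∀ t ∈ Finset.Ico k (n e), g e t ≤ bg (B + bn B) := by
      intro t ht
      refine hg1 (B + bn B) (fun o => o.elim t e) ?_
      rintro (_ | i)
      · exact ((Finset.mem_Ico.1 ht).2.le.trans (hn1 B e he)).trans (Nat.le_add_left _ _)
      · exact (he i).trans (Nat.le_add_right _ _)
    refine (Finset.sum_le_card_nsmul _ _ _ h1).trans ?_
    rw [Nat.card_Ico, smul_eq_mul]
    exact Nat.mul_le_mul_right _ ((Nat.sub_le _ _).trans (hn1 B e he))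
  · rw [downFold_add, zero_add]

theorem mul {f g : (ι → ℕ) → ℕ} (hf : PolyComputable f) (hg : PolyComputable g) :
    PolyComputable fun e => f e * g e :=
  (sum (g := fun e _ => g e) hf (hg.rename some)).congr fun e => by simp

/-- `x / q` counts the `t < x` with `(t + 1) * q ≤ x`. The factor `1 - (1 - q)` is the sign of `q`
and gives the value `0` for `q = 0`. -/
theorem div {f g : (ι → ℕ) → ℕ} (hf : PolyComputable f) (hg : PolyComputable g) :
    PolyComputable fun e => f e / g e := by
  refine ((sum (g := fun e t => 1 - ((t + 1) * g e - f e)) hf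
    ((const 1).sub (((proj none).succ.mul (hg.rename some)).sub (hf.rename some)))).mul
    ((const 1).sub ((const 1).sub hg))).congr fun e => ?_
  generalize f e = x
  rcases (g e).eq_zero_or_pos with h | h
  · simp [h]
  generalize g e = q at *
  have h1 : ∀ t ∈ Finset.range x, 1 - ((t + 1) * q - x) = if t < x / q then 1 else 0 := by
    intro t _
    have : t < x / q ↔ (t + 1) * q ≤ x := by rw [← Nat.succ_le_iff, Nat.le_div_iff_mul_le h]
    split_ifs <;> omega
  rw [Finset.sum_congr rfl h1, ← Finset.card_filter, show 1 - (1 - q) = 1 by omega, mul_one]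
  have h2 : (Finset.range x).filter (fun t => t < x / q) = Finset.range (x / q) := by
    ext t
    have := Nat.div_le_self x q
    simp
    omega
  rw [h2, Finset.card_range]

theorem mod {f g : (ι → ℕ) → ℕ} (hf : PolyComputable f) (hg : PolyComputable g) :
    PolyComputable fun e => f e % g e :=
  (hf.sub (hg.mul (hf.div hg))).congr fun _ => Nat.mod_eq_sub _ _

theorem dist {f g : (ι → ℕ) → ℕ} (hf : PolyComputable f) (hg : PolyComputable g) :
    PolyComputable fun e => Nat.dist (f e) (g e) :=
  (hf.sub hg).add (hg.sub hf)

/-- Dividing by `q` repeatedly avoids forming `q ^ t`, which need not be polynomially bounded. -/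
theorem div_pow {f g h : (ι → ℕ) → ℕ} (hf : PolyComputable f) (hg : PolyComputable g)
    (hh : PolyComputable h) : PolyComputable fun e => f e / g e ^ h e := by
  refine comp₃ (F := fun x q t => x / q ^ t) ?_ hf hg hh
  refine (fold (n := fun e => e 2) (f := fun e _ a => a / e 1) (proj 2) (proj 0)
    ((proj (some none)).div (proj (some (some 1)))) (fun e _ a => a ≤ e 0) (fun e => le_rfl)
    (fun _ _ _ _ h => (Nat.div_le_self _ _).trans h) PolyBounded.id
    (fun B e he k a _ h => h.trans (he 0))).congr fun e => ?_
  rw [downFold_const]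
  generalize e 0 = x
  induction e 2 generalizing x with
  | zero => simp
  | succ n ih => rw [Function.iterate_succ_apply, ← ih, Nat.div_div_eq_div_mul, pow_succ']

end PolyComputable

/-! ### Writing out the adjacency matrix -/

theorem downFold_cons {β : Type*} (g : ℕ → β) (n : ℕ) (l : List β) :
    downFold (fun k l => g k :: l) n l = (List.range n).map g ++ l := by
  induction n generalizing l with
  | zero => rfl
  | succ n ih =>
    rw [downFold, ih]
    simp [List.range_succ]

theorem downFold_append {β : Type*} (g : ℕ → List β) (n : ℕ) (l : List β) :
    downFold (fun k l => g k ++ l) n l = (List.range n).flatMap g ++ l := by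
  induction n generalizing l with
  | zero => rfl
  | succ n ih =>
    rw [downFold, ih]
    simp [List.range_succ]

/-- A polynomial-time program writing out the `n × n` matrix of the truth values of
`f n i j ≠ 0`. -/
theorem PolyComputable.exists_matrix_program {f : ℕ → ℕ → ℕ → ℕ}
    (hf : PolyComputable fun e : Fin 3 → ℕ => f (e 0) (e 1) (e 2)) :
    ∃ p T, PolyBounded T ∧ ∀ n, Runs p ⟨Function.update 0 0 n, []⟩
      ⟨0, (List.range n).flatMap fun i => (List.range n).map fun j => decide (f n i j ≠ 0)⟩
      (T n) := by
  obtain ⟨b, hb, hf1⟩ := hf.bounded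
  obtain ⟨p, T, hT, hp⟩ := hf.computes ![0, 1, 2] 3 (by decide)
  let st : ℕ → ℕ → ℕ → List Bool → Mem := fun n i j l =>
    ⟨Function.update (Function.update (Function.update 0 0 n) 1 i) 2 j, l⟩
  have hst : ∀ n i j l r, 3 ≤ r → (st n i j l).reg r = 0 := by
    intro n i j l r hr
    simp only [st, Function.update_apply]
    rw [if_neg (by omega), if_neg (by omega), if_neg (by omega)]
    rfl
  have copy : ∀ n i j l w, 0 < w → w < 3 → (st n i j l).reg w = 0 →
      Runs (.copy 0 w 3) (st n i j l) ((st n i j l).set w n) (5 * n + 2) := by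
    intro n i j l w h0 h3 h
    have := Runs.copy (st n i j l) (v := 0) (w := w) (x := 3) (by omega) (by omega) (by omega)
      (hst _ _ _ _ _ le_rfl)
    rw [h, zero_add] at this
    exact this
  have inner : ∀ n i j l, i ≤ n → j ≤ n →
      Runs (.seq (.seq p (.emit 3)) (.loop 3 .skip)) (st n i j l)
        (st n i j (decide (f n i j ≠ 0) :: l)) (T n + 2 * b n + 2) := by
    intro n i j l hi hj
    have e1 : ∀ k, (st n i j l).reg ((![0, 1, 2] : Fin 3 → ℕ) k) = (![n, i, j] : Fin 3 → ℕ) k := by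
      intro k
      fin_cases k <;> simp [st]
    have h1 : ∀ k, (![n, i, j] : Fin 3 → ℕ) k ≤ n := by
      intro k
      fin_cases k <;> simp [hi, hj]
    have r := ((hp (st n i j l) n (fun r hr => hst _ _ _ _ _ hr) fun k => (e1 k).trans_le (h1 k)).seq
      ⟨1, le_rfl, .emit _ 3⟩).seq (Runs.clear _ 3)
    simp only [e1] at r
    have h2 : f n i j ≤ b n := hf1 n _ h1
    refine Eq.mp ?_ (r.mono (T' := T n + 2 * b n + 2) ?_)
    · congr 1
      ext1
      · funext r
        have := hst n i j l 3 le_rfl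
        simp only [Mem.set, Function.update_apply]
        split_ifs
        · subst r
          exact this.symm
        · rfl
      · simp [Mem.set, st]
    · simp [Mem.set]
      omega
  have row : ∀ n i l, i ≤ n →
      Runs (.seq (.copy 0 2 3) (.loop 2 (.seq (.seq p (.emit 3)) (.loop 3 .skip)))) (st n i 0 l)
        (st n i 0 ((List.range n).map (fun j => decide (f n i j ≠ 0)) ++ l))
        (5 * n + 2 + ((T n + 2 * b n + 2 + 1) * n + 1)) := by
    intro n i l hi
    refine (copy n i 0 l 2 (by omega) (by omega) (by simp [st])).seq ?_
    have := Runs.loop (v := 2) (n := n) (st n i) (fun j l => decide (f n i j ≠ 0) :: l)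
      (fun _ _ => True) (by simp [st])
      (fun k a hk _ => ⟨trivial, by simpa [Mem.set, st] using inner n i k a hi hk.le⟩) l trivial
    rw [downFold_cons] at this
    simpa [Mem.set, st] using this
  have hconst := PolyBounded.const
  refine ⟨.seq (.seq (.copy 0 1 3)
    (.loop 1 (.seq (.copy 0 2 3) (.loop 2 (.seq (.seq p (.emit 3)) (.loop 3 .skip))))))
    (.loop 0 .skip), fun n => 5 * n + 2 +
      ((5 * n + 2 + ((T n + 2 * b n + 2 + 1) * n + 1) + 1) * n + 1) + (2 * n + 1), ?_, fun n => ?_⟩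
  · have h5 := ((hconst 5).mul .id).add (hconst 2)
    exact (h5.add ((((h5.add (((((hT.add ((hconst 2).mul hb)).add (hconst 2)).add
      (hconst 1)).mul .id).add (hconst 1))).add (hconst 1)).mul .id).add (hconst 1))).add
      (((hconst 2).mul .id).add (hconst 1))
  · have h0 : (⟨Function.update 0 0 n, []⟩ : Mem) = st n 0 0 [] := by
      ext1
      · funext r
        simp only [st, Function.update_apply]
        split_ifs <;> simp_all
      · rfl
    rw [h0]
    have r1 := copy n 0 0 [] 1 (by omega) (by omega) (by simp [st])
    have r2 := Runs.loop (v := 1) (n := n) (fun i => st n i 0)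
      (fun i l => (List.range n).map (fun j => decide (f n i j ≠ 0)) ++ l)
      (fun _ _ => True) (by simp [st])
      (fun k a hk _ => ⟨trivial, by
        have e : (st n (k + 1) 0 a).set 1 k = st n k 0 a := by
          ext1
          · funext r
            simp only [st, Mem.set, Function.update_apply]
            split_ifs <;> simp_all
          · rfl
        rw [e]
        exact row n k a hk.le⟩) [] trivial
    have e : (st n 0 0 []).set 1 n = st n n 0 [] := by
      ext1
      · funext r
        simp only [st, Mem.set, Function.update_apply]
        split_ifs <;> simp_all
      · rfl
    rw [e] at r1
    rw [downFold_append] at r2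
    convert ((r1.seq r2).seq (Runs.clear _ 0)) using 1
    · ext1
      · funext r
        simp only [st, Mem.set, Function.update_apply]
        split_ifs <;> simp_all
      · simp [st, Mem.set]
    · simp [st]

theorem PolyComputable.polyTimeOutputsAdjMatrix {f : ℕ → ℕ → ℕ → ℕ}
    (hf : PolyComputable fun e : Fin 3 → ℕ => f (e 0) (e 1) (e 2))
    {H : (n : ℕ) → SimpleGraph (Fin n)} (hH : ∀ n i j, (H n).Adj i j ↔ f n i j ≠ 0) :
    PolyTimeOutputsAdjMatrix H := by
  obtain ⟨p, T, ⟨c, hc⟩, hp⟩ := hf.exists_matrix_program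
  have hlen : ∀ n, Computability.unaryEncodeNat n = List.replicate n true := by
    intro n
    induction n with
    | zero => rfl
    | succ n ih => rw [Computability.unaryEncodeNat, ih, List.replicate_succ]
  have hout : ∀ n, matrixBits ⟨n, boolAdjMatrix (H n)⟩ =
      (List.range n).flatMap fun i => (List.range n).map fun j => decide (f n i j ≠ 0) := by
    intro n
    simp only [matrixBits, boolAdjMatrix, Matrix.of_apply, hH, ← List.map_coe_finRange_eq_range,
      List.flatMap_map, List.map_map]
    rfl
  refine ⟨⟨⟨machine p, Equiv.refl _, Equiv.refl _⟩, (Polynomial.X + 2) ^ c + 1, fun n => ?_⟩⟩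
  refine Classical.choice ?_
  obtain ⟨t, ht, h⟩ := hp n
  obtain ⟨h⟩ := machine_outputs h
  have e1 : List.map (Equiv.refl Bool).invFun (Computability.unaryEncodeNat n) =
      List.replicate n true := by
    rw [hlen]
    exact List.map_id _
  have e2 : List.map (Equiv.refl Bool).invFun (matrixBits ⟨n, boolAdjMatrix (H n)⟩) =
      (List.range n).flatMap fun i => (List.range n).map fun j => decide (f n i j ≠ 0) := by
    rw [hout]
    exact List.map_id _
  have e3 : t + 1 ≤ ((Polynomial.X + 2) ^ c + 1 : Polynomial ℕ).eval
      (Computability.unaryEncodeNat n).length := by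
    rw [hlen]
    simpa using ht.trans (hc n)
  refine ⟨⟨⟨h.steps, ?_⟩, h.steps_le_m.trans e3⟩⟩
  exact (congrArg (fun l => (flip Bind.bind (machine p).step)^[h.steps]
    (some (Turing.initList (machine p) l))) e1).trans
    (h.evals_in_steps.trans (congrArg (fun l => some (Turing.haltList (machine p) l)) e2.symm))

end CounterProgram

/-! ### Rank bounds for set families -/

/-- A family of pairs of functions that is orthogonal off the diagonal, and not on it, is at most
as large as the set on which the functions are defined. -/
theorem card_le_of_orthogonal {F ι D : Type*} [Field F] [Fintype D] (S : Finset ι)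
    (a b : ι → D → F) (hd : ∀ x ∈ S, ∑ d, a x d * b x d ≠ 0)
    (ho : ∀ x ∈ S, ∀ y ∈ S, x ≠ y → ∑ d, a x d * b y d = 0) : S.card ≤ Fintype.card D := by
  classical
  let A : Matrix S D F := Matrix.of fun x d => a x d
  let B : Matrix D S F := Matrix.of fun d y => b y d
  -- A diagonal matrix with nonzero entries has rank `S.card`, yet this one factors through `D`.
  have h : A * B = Matrix.diagonal fun x : S => ∑ d, a x d * b x d := by
    ext x y
    rw [Matrix.mul_apply, Matrix.diagonal_apply]
    split_ifs with hxy
    · subst hxy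
      rfl
    · exact ho x x.2 y y.2 fun h => hxy (Subtype.ext h)
  have h1 : (A * B).rank = S.card := by
    rw [h, Matrix.rank_diagonal, ← Fintype.card_coe]
    exact Fintype.card_congr (Equiv.subtypeUnivEquiv fun x : S => hd x x.2)
  rw [← h1]
  exact (Matrix.rank_mul_le_left A B).trans A.rank_le_card_width

/-- Set families with restricted intersections, modulo `2`. -/
theorem card_le_choose_of_even_choose_inter {ι U : Type*} [Fintype U] [DecidableEq U]
    (S : Finset ι) (G : ι → Finset U) (s : ℕ) (hd : ∀ x ∈ S, Odd ((G x).card.choose s))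
    (ho : ∀ x ∈ S, ∀ y ∈ S, x ≠ y → Even ((G x ∩ G y).card.choose s)) :
    S.card ≤ (Fintype.card U).choose s := by
  -- The vectors are the inclusion indicators of the `s`-subsets; their inner product counts the
  -- `s`-subsets of the intersection.
  have key : ∀ x y, ∑ T : {T : Finset U // T.card = s},
      (if T.1 ⊆ G x then 1 else 0 : ZMod 2) * (if T.1 ⊆ G y then 1 else 0) =
        ((G x ∩ G y).card.choose s : ℕ) := by
    intro x y
    have h1 : ∀ T : Finset U, (if T ⊆ G x then 1 else 0 : ZMod 2) * (if T ⊆ G y then 1 else 0) =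
        if T ⊆ G x ∩ G y then 1 else 0 := by
      intro T
      simp only [Finset.subset_inter_iff]
      split_ifs <;> simp_all
    simp only [h1]
    rw [← Finset.card_powersetCard, ← Finset.sum_subtype (Finset.powersetCard s Finset.univ)
      (fun T => by simp [Finset.mem_powersetCard]) (fun T => if T ⊆ G x ∩ G y then (1 : ZMod 2) else 0),
      ← Finset.sum_filter, Finset.sum_const, nsmul_one]
    congr 2
    ext T
    simp [Finset.mem_powersetCard, and_comm]
  rw [← Fintype.card_finset_len]
  refine card_le_of_orthogonal S (fun x T => (if T.1 ⊆ G x then 1 else 0 : ZMod 2))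
    (fun x T => if T.1 ⊆ G x then 1 else 0) (fun x hx => ?_) fun x hx y hy hxy => ?_
  · rw [key, Finset.inter_self, ZMod.natCast_ne_zero_iff_odd]
    exact hd x hx
  · rw [key, ZMod.natCast_eq_zero_iff_even]
    exact ho x hx y hy hxy

/-- Set families with restricted intersections, in characteristic zero. -/
theorem card_le_pow_of_card_inter_mem {ι U : Type*} [Fintype U] [DecidableEq U]
    (S : Finset ι) (G : ι → Finset U) (L : Finset ℕ) (hd : ∀ x ∈ S, (G x).card ∉ L)
    (ho : ∀ x ∈ S, ∀ y ∈ S, x ≠ y → (G x ∩ G y).card ∈ L) :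
    S.card ≤ (Fintype.card U + 1) ^ L.card := by
  -- The coordinate `none` carries the constant term, so that `|G x ∩ G y| - l` is an inner product.
  -- The product over `l ∈ L` expands into a sum over maps `L → Option U`, whose number is the
  -- bound.
  let α : ι → Option U → ℚ := fun x o => o.elim 1 fun u => if u ∈ G x then 1 else 0
  let β : ℕ → ι → Option U → ℚ := fun l x o => o.elim (-l) fun u => if u ∈ G x then 1 else 0
  have h1 : ∀ x y l, ∑ o, α x o * β l y o = ((G x ∩ G y).card : ℚ) - l := by
    intro x y l
    have h2 : ∀ u, (if u ∈ G x then 1 else 0 : ℚ) * (if u ∈ G y then 1 else 0) =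
        if u ∈ G x ∩ G y then 1 else 0 := by
      intro u
      simp only [Finset.mem_inter]
      split_ifs <;> simp_all
    rw [Fintype.sum_option]
    simp only [α, β, Option.elim, h2]
    rw [Finset.sum_ite_mem, Finset.univ_inter, Finset.sum_const, nsmul_one]
    ring
  have key : ∀ x y, ∑ φ : L → Option U, (∏ l, α x (φ l)) * ∏ l : L, β l y (φ l) =
      ∏ l : L, (((G x ∩ G y).card : ℚ) - l) := by
    intro x y
    simp only [← h1, Finset.prod_univ_sum, Fintype.piFinset_univ, Finset.prod_mul_distrib]
  have hcard : Fintype.card (L → Option U) = (Fintype.card U + 1) ^ L.card := by simp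
  rw [← hcard]
  refine card_le_of_orthogonal S (fun x φ => ∏ l, α x (φ l)) (fun x φ => ∏ l : L, β l x (φ l))
    (fun x hx => ?_) fun x hx y hy hxy => ?_
  · rw [key, Finset.inter_self, Finset.prod_ne_zero_iff]
    rintro ⟨l, hl⟩ - h
    have : (G x).card = l := by exact_mod_cast sub_eq_zero.1 h
    exact hd x hx (this ▸ hl)
  · rw [key]
    exact Finset.prod_eq_zero (Finset.mem_univ ⟨_, ho x hx y hy hxy⟩) (sub_self _)

/-- Lucas modulo 2: all `k` binary digits of `2 ^ k - 1` are `1`, so the last `k` digits of `a` must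
be `1` too. The induction strips off the lowest digit. -/
theorem odd_choose_two_pow_sub_one_iff (k a : ℕ) :
    Odd (a.choose (2 ^ k - 1)) ↔ a % 2 ^ k = 2 ^ k - 1 := by
  induction k generalizing a with
  | zero => simp [Nat.mod_one]
  | succ k ih =>
    have hpos := Nat.two_pow_pos k
    have h := Choose.choose_modEq_choose_mod_mul_choose_div_nat (n := a) (k := 2 ^ (k + 1) - 1)
      (p := 2)
    have e1 : (2 ^ (k + 1) - 1) % 2 = 1 := by omega
    have e2 : (2 ^ (k + 1) - 1) / 2 = 2 ^ k - 1 := by omega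
    rw [e1, e2, Nat.choose_one_right] at h
    rw [Nat.odd_iff, h, ← Nat.odd_iff, Nat.odd_mul, ih, pow_succ', Nat.mod_mul]
    rcases Nat.mod_two_eq_zero_or_one a with h2 | h2
    · simp [h2]
      omega
    · simp [h2]
      omega

/-! ### The digit graph, its cliques and independent sets -/

/-- The number of the last `q ^ 2 - 1` digits in base `q` in which two numbers agree. -/
def digitAgreement (q i j : ℕ) : ℕ :=
  ∑ t ∈ Finset.range (q * q - 1), (1 - Nat.dist (i / q ^ t % q) (j / q ^ t % q))

theorem digitAgreement_comm (q i j : ℕ) : digitAgreement q i j = digitAgreement q j i := by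
  simp only [digitAgreement, Nat.dist_comm]

theorem digitAgreement_self (q i : ℕ) : digitAgreement q i i = q * q - 1 := by
  simp [digitAgreement]

theorem eq_of_digits_eq {q m i j : ℕ} (hi : i < q ^ m) (hj : j < q ^ m)
    (h : ∀ t < m, i / q ^ t % q = j / q ^ t % q) : i = j := by
  have key : ∀ t ≤ m, i % q ^ t = j % q ^ t := by
    intro t
    induction t with
    | zero => simp [Nat.mod_one]
    | succ t ih =>
      intro ht
      rw [Nat.mod_pow_succ, Nat.mod_pow_succ, ih (by omega), h t ht]
  have := key m le_rfl
  rwa [Nat.mod_eq_of_lt hi, Nat.mod_eq_of_lt hj] at this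

theorem digitAgreement_lt {q i j : ℕ} (hi : i < q ^ (q * q - 1)) (hj : j < q ^ (q * q - 1))
    (hij : i ≠ j) : digitAgreement q i j < q * q - 1 := by
  have h : ∃ t ∈ Finset.range (q * q - 1), i / q ^ t % q ≠ j / q ^ t % q := by
    by_contra! h
    exact hij (eq_of_digits_eq hi hj fun t ht => h t (Finset.mem_range.2 ht))
  obtain ⟨t, ht, h⟩ := h
  have h1 := Nat.dist_pos_of_ne h
  calc digitAgreement q i j < ∑ t ∈ Finset.range (q * q - 1), 1 :=
        Finset.sum_lt_sum (fun _ _ => Nat.sub_le _ _) ⟨t, ht, by omega⟩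
    _ = q * q - 1 := by simp

/-- The set of pairs (position, digit) of the last `q ^ 2 - 1` digits in base `q`. -/
def digitSet (q : ℕ) [NeZero q] (i : ℕ) : Finset (Fin (q * q - 1) × Fin q) :=
  Finset.univ.image fun t : Fin (q * q - 1) => (t, Fin.ofNat q (i / q ^ (t : ℕ)))

/-- The sets are graphs of digit functions and meet over the positions of agreement; the truncated
`1 - dist` is the indicator of equality. -/
theorem card_digitSet_inter (q : ℕ) [NeZero q] (i j : ℕ) :
    (digitSet q i ∩ digitSet q j).card = digitAgreement q i j := by
  have h : digitSet q i ∩ digitSet q j = (Finset.univ.filter fun t : Fin (q * q - 1) =>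
      i / q ^ (t : ℕ) % q = j / q ^ (t : ℕ) % q).image
        fun t : Fin (q * q - 1) => (t, Fin.ofNat q (i / q ^ (t : ℕ))) := by
    ext ⟨t, c⟩
    simp only [digitSet, Finset.mem_inter, Finset.mem_image, Finset.mem_univ, true_and,
      Prod.mk.injEq, exists_eq_left, Finset.mem_filter]
    constructor
    · rintro ⟨h1, h2⟩
      exact ⟨t, congrArg Fin.val (h1.trans h2.symm), rfl, h1⟩
    · rintro ⟨t', h1, rfl, h2⟩
      exact ⟨h2, (Fin.ext h1.symm : Fin.ofNat q _ = Fin.ofNat q _).trans h2⟩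
  rw [h, Finset.card_image_of_injective _ fun t t' h => (Prod.mk.inj h).1, Finset.card_filter,
    digitAgreement, ← Fin.sum_univ_eq_sum_range
      (fun t => 1 - Nat.dist (i / q ^ t % q) (j / q ^ t % q))]
  refine Finset.sum_congr rfl fun t _ => ?_
  split_ifs with h
  · simp [h]
  · have := Nat.dist_pos_of_ne h
    omega

theorem card_digitSet (q : ℕ) [NeZero q] (i : ℕ) : (digitSet q i).card = q * q - 1 := by
  rw [← Finset.inter_self (digitSet q i), card_digitSet_inter, digitAgreement_self]

theorem sq_sub_one_mod {q : ℕ} (hq : 0 < q) : (q * q - 1) % q = q - 1 := by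
  obtain ⟨r, rfl⟩ := Nat.exists_eq_succ_of_ne_zero hq.ne'
  rw [show r.succ * r.succ - 1 = r + r.succ * r by simp; ring_nf; omega, Nat.add_mul_mod_self_left,
    Nat.mod_eq_of_lt r.lt_succ_self, Nat.succ_sub_one]

/-- The graph in which two numbers are adjacent if the number of digits in which they agree is not
`-1` modulo the base. -/
def digitGraph (q n : ℕ) (hq : 0 < q) : SimpleGraph (Fin n) where
  Adj i j := digitAgreement q i j % q ≠ q - 1
  symm := ⟨fun i j h => by rwa [digitAgreement_comm]⟩
  loopless := ⟨fun i h => h (by rw [digitAgreement_self, sq_sub_one_mod hq])⟩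

theorem card_le_of_isClique_digitGraph {k n : ℕ} {S : Finset (Fin n)}
    (hS : (digitGraph (2 ^ k) n (Nat.two_pow_pos k)).IsClique (S : Set (Fin n))) :
    S.card ≤ ((2 ^ k) ^ 3) ^ (2 ^ k - 1) := by
  have hq := Nat.two_pow_pos k
  have : NeZero (2 ^ k) := ⟨hq.ne'⟩
  have h := card_le_choose_of_even_choose_inter S (fun i => digitSet (2 ^ k) i) (2 ^ k - 1)
    (fun i _ => by rw [card_digitSet, odd_choose_two_pow_sub_one_iff, sq_sub_one_mod hq])
    (fun i hi j hj hij => by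
      rw [card_digitSet_inter, ← Nat.not_odd_iff_even, odd_choose_two_pow_sub_one_iff]
      exact hS hi hj hij)
  refine (h.trans (Nat.choose_le_pow _ _)).trans (Nat.pow_le_pow_left ?_ _)
  rw [Fintype.card_prod, Fintype.card_fin, Fintype.card_fin]
  calc (2 ^ k * 2 ^ k - 1) * 2 ^ k ≤ (2 ^ k * 2 ^ k) * 2 ^ k := by gcongr; omega
    _ = (2 ^ k) ^ 3 := by ring

/-- By `hn` distinct vertices are distinct words, so they agree in fewer than `q ^ 2 - 1` positions.
Being `-1` modulo `q`, the agreement is `l * q + (q - 1)` with `l < q - 1`; the excluded `l = q - 1`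
is the diagonal value. -/
theorem card_le_of_isIndepSet_digitGraph {q n : ℕ} (hq : 0 < q) (hn : n ≤ q ^ (q * q - 1))
    {S : Finset (Fin n)} (hS : (digitGraph q n hq).IsIndepSet (S : Set (Fin n))) :
    S.card ≤ (q ^ 3) ^ (q - 1) := by
  have : NeZero q := ⟨hq.ne'⟩
  have h := card_le_pow_of_card_inter_mem S (fun i => digitSet q i)
    ((Finset.range (q - 1)).image fun l => l * q + (q - 1))
    (fun i _ => by
      rw [card_digitSet, Finset.mem_image]
      rintro ⟨l, hl, h⟩
      rw [Finset.mem_range] at hl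
      have : (l + 2) * q ≤ q * q := Nat.mul_le_mul_right q (by omega)
      rw [add_mul] at this
      omega)
    (fun i hi j hj hij => by
      have h1 : digitAgreement q i j % q = q - 1 := not_not.1 (hS hi hj hij)
      have h2 := digitAgreement_lt (i.2.trans_le hn) (j.2.trans_le hn) (Fin.val_ne_of_ne hij)
      have h3 := Nat.div_add_mod' (digitAgreement q i j) q
      rw [card_digitSet_inter, Finset.mem_image]
      refine ⟨_, Finset.mem_range.2 ?_, by rw [← h1]; exact h3⟩
      by_contra h4
      have : (q - 1) * q ≤ digitAgreement q i j / q * q := Nat.mul_le_mul_right q (by omega)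
      rw [Nat.sub_mul] at this
      omega)
  refine h.trans ((Nat.pow_le_pow_right (Nat.succ_pos _)
    (Finset.card_image_le.trans (Finset.card_range _).le)).trans (Nat.pow_le_pow_left ?_ _))
  rw [Fintype.card_prod, Fintype.card_fin, Fintype.card_fin, Nat.sub_mul]
  have : q * 1 ≤ q * q * q := by nlinarith [Nat.mul_le_mul hq hq]
  have e : q ^ 3 = q * q * q := by ring
  omega

/-! ### Choice of the base -/

/-- The least `2 ^ k ≥ 2` with `n < q ^ (q ^ 2 - 1)`. -/
def digitBase (n : ℕ) : ℕ := (fun q => if n < q ^ (q * q - 1) then q else 2 * q)^[n] 2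

theorem digitBase_spec (n : ℕ) : ∃ k, digitBase n = 2 ^ (k + 1) ∧
    n < digitBase n ^ (digitBase n * digitBase n - 1) ∧
    (k = 0 ∨ (2 ^ k) ^ (2 ^ k * 2 ^ k - 1) ≤ n) := by
  have key : ∀ j, ∃ k, (fun q => if n < q ^ (q * q - 1) then q else 2 * q)^[j] 2 = 2 ^ (k + 1) ∧
      (n < (2 ^ (k + 1)) ^ (2 ^ (k + 1) * 2 ^ (k + 1) - 1) ∨ k = j) ∧
      (k = 0 ∨ (2 ^ k) ^ (2 ^ k * 2 ^ k - 1) ≤ n) := by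
    intro j
    induction j with
    | zero => exact ⟨0, rfl, Or.inr rfl, Or.inl rfl⟩
    | succ j ih =>
      obtain ⟨k, h1, h2, h3⟩ := ih
      rw [Function.iterate_succ_apply', h1]
      by_cases h : n < (2 ^ (k + 1)) ^ (2 ^ (k + 1) * 2 ^ (k + 1) - 1)
      · exact ⟨k, if_pos h, Or.inl h, h3⟩
      · refine ⟨k + 1, by rw [if_neg h, pow_succ' 2 (k + 1)], Or.inr ?_, Or.inr (not_lt.1 h)⟩
        rw [h2.resolve_left h]
  obtain ⟨k, h1, h2, h3⟩ := key n
  refine ⟨k, h1, ?_, h3⟩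
  rw [digitBase, h1]
  rcases h2 with h2 | rfl
  · exact h2
  -- If all `n` rounds doubled, the base is `2 ^ (n + 1)`, which already exceeds `n`.
  · have h4 : 2 ^ (k + 1) * 1 ≤ 2 ^ (k + 1) * 2 ^ (k + 1) := Nat.mul_le_mul_left _ Nat.one_le_two_pow
    have h5 : k + 1 < 2 ^ (k + 1) := Nat.lt_two_pow_self
    calc k < 2 ^ (k + 1) := by omega
      _ = (2 ^ (k + 1)) ^ 1 := (pow_one _).symm
      _ ≤ _ := Nat.pow_le_pow_right (by omega) (by omega)

theorem digitBase_pos (n : ℕ) : 0 < digitBase n := by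
  obtain ⟨k, h, -⟩ := digitBase_spec n
  rw [h]
  exact Nat.two_pow_pos _

/-! ### Computability of the graph -/

namespace CounterProgram.PolyComputable

variable {ι : Type}

/-- The test `n < q ^ (q * q - 1)` is made through the quotient, so the power is never formed.
Doubling happens only when `q ≤ q ^ (q * q - 1) ≤ n`, which keeps `q` at most `2 * n + 2`. -/
theorem digitBase {n : (ι → ℕ) → ℕ} (hn : PolyComputable n) :
    PolyComputable fun e => _root_.digitBase (n e) := by
  have hstep : ∀ m q, q + q * (1 - (1 - m / q ^ (q * q - 1))) =
      if m < q ^ (q * q - 1) then q else 2 * q := by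
    intro m q
    have hpos : 0 < q ^ (q * q - 1) := by
      rcases q.eq_zero_or_pos with rfl | h
      · exact Nat.one_pos
      · exact Nat.pow_pos h
    split_ifs with h
    · simp [Nat.div_eq_of_lt h]
    · have := (Nat.div_pos (not_lt.1 h) hpos)
      rw [show 1 - (1 - m / q ^ (q * q - 1)) = 1 by omega]
      omega
  have q : PolyComputable fun e : Option (Option ι) → ℕ => e (some none) := proj _
  refine (fold (f := fun e _ q => q + q * (1 - (1 - n e / q ^ (q * q - 1)))) hn (const 2)
    (q.add (q.mul ((const 1).sub ((const 1).sub
      (((hn.rename some).rename some).div_pow q (q.mul q).pred)))))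
    (fun e _ q => 2 ≤ q ∧ q ≤ 2 * n e + 2) (fun e => ⟨le_rfl, by omega⟩) ?_
    (((PolyBounded.const 2).mul hn.bounded.choose_spec.1).add (.const 2)) ?_).congr fun e => ?_
  · rintro e - q - ⟨h1, h2⟩
    rw [hstep]
    split_ifs with h
    · exact ⟨h1, h2⟩
    · have h3 : q * 2 ≤ q * q := Nat.mul_le_mul_left q h1
      have h4 : q ^ 1 ≤ q ^ (q * q - 1) := Nat.pow_le_pow_right (by omega) (by omega)
      rw [pow_one] at h4
      omega
  · rintro B e he k q - ⟨-, h⟩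
    have := hn.bounded.choose_spec.2 B e he
    omega
  · simp only [hstep]
    rw [downFold_const, _root_.digitBase]

theorem digitAgreement {q i j : (ι → ℕ) → ℕ} (hq : PolyComputable q) (hi : PolyComputable i)
    (hj : PolyComputable j) :
    PolyComputable fun e => _root_.digitAgreement (q e) (i e) (j e) := by
  have digit : ∀ {i : (ι → ℕ) → ℕ}, PolyComputable i → PolyComputable fun e : Option ι → ℕ =>
      i (fun o => e (some o)) / q (fun o => e (some o)) ^ e none % q (fun o => e (some o)) :=
    fun hi => ((hi.rename some).div_pow (hq.rename some) (proj none)).mod (hq.rename some)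
  exact sum (g := fun e t => 1 - Nat.dist (i e / q e ^ t % q e) (j e / q e ^ t % q e))
    ((hq.mul hq).pred) ((const 1).sub ((digit hi).dist (digit hj)))

theorem digitGraph_adj : PolyComputable fun e : Fin 3 → ℕ =>
    Nat.dist (_root_.digitAgreement (_root_.digitBase (e 0)) (e 1) (e 2) % _root_.digitBase (e 0))
      (_root_.digitBase (e 0) - 1) :=
  have hq := (proj (0 : Fin 3)).digitBase
  ((hq.digitAgreement (proj 1) (proj 2)).mod hq).dist hq.pred

end CounterProgram.PolyComputable

theorem polyTimeOutputsAdjMatrix_digitGraph :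
    PolyTimeOutputsAdjMatrix fun n => digitGraph (digitBase n) n (digitBase_pos n) := by
  refine CounterProgram.PolyComputable.digitGraph_adj.polyTimeOutputsAdjMatrix (f := fun n i j =>
    Nat.dist (digitAgreement (digitBase n) i j % digitBase n) (digitBase n - 1)) fun n i j => ?_
  exact not_congr ⟨fun h => by rw [h, Nat.dist_self], Nat.eq_of_dist_eq_zero⟩

/-! ### Asymptotics and conclusion -/

theorem le_of_le_of_digitBase_eq {K k n : ℕ} (hn : (2 ^ K) ^ (2 ^ K * 2 ^ K - 1) ≤ n)
    (hk : digitBase n = 2 ^ (k + 1)) : K ≤ k := by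
  obtain ⟨k', h1, h2, -⟩ := digitBase_spec n
  by_contra! h
  rw [hk] at h2
  have h3 : 2 ^ (k + 1) ≤ 2 ^ K := Nat.pow_le_pow_right (by omega) h
  have h4 : (2 ^ (k + 1)) ^ (2 ^ (k + 1) * 2 ^ (k + 1) - 1) ≤ (2 ^ K) ^ (2 ^ K * 2 ^ K - 1) :=
    (Nat.pow_le_pow_left h3 _).trans (Nat.pow_le_pow_right (Nat.two_pow_pos K)
      (Nat.sub_le_sub_right (Nat.mul_le_mul h3 h3) 1))
  omega

theorem le_logb_of_pow_le {k n : ℕ} (hk : 1 ≤ k) (hn : (2 ^ k) ^ (2 ^ k * 2 ^ k - 1) ≤ n) :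
    (2 ^ k : ℝ) ^ 2 * (k / 2) ≤ Real.logb 2 n := by
  have h1 : (2 : ℝ) ^ (((k * (2 ^ k * 2 ^ k - 1) : ℕ)) : ℝ) ≤ n := by
    rw [Real.rpow_natCast, pow_mul]
    exact_mod_cast hn
  have h2 : ((k * (2 ^ k * 2 ^ k - 1) : ℕ) : ℝ) ≤ Real.logb 2 n := by
    rwa [Real.le_logb_iff_rpow_le one_lt_two (lt_of_lt_of_le (by positivity) h1)]
  refine le_trans ?_ h2
  have h3 : 2 ≤ 2 ^ k := Nat.le_self_pow (by omega) 2
  have h4 : 1 ≤ 2 ^ k * 2 ^ k := by nlinarith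
  rw [Nat.cast_mul, Nat.cast_sub h4]
  push_cast
  have h5 : (2 : ℝ) ≤ 2 ^ k := by exact_mod_cast h3
  have h6 : (0 : ℝ) ≤ k := k.cast_nonneg
  nlinarith [mul_nonneg h6 (show (0 : ℝ) ≤ 2 ^ k * 2 ^ k - 2 by nlinarith)]

/-- From `log n ≥ 4 ^ k * k / 2` come `sqrt (log n) ≥ 2 ^ k * sqrt (k / 2)` and `log log n ≥ k`.
What remains is `12 ≤ ε * sqrt (k / 2)`, that is, `288 / ε ^ 2 ≤ k`. -/
theorem lt_mul_sqrt_logb_mul_logb_logb {ε : ℝ} (hε : 0 < ε) {k n : ℕ} (hk : 1 ≤ k)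
    (hkε : 288 / ε ^ 2 ≤ k) (hn : (2 ^ k) ^ (2 ^ k * 2 ^ k - 1) ≤ n) :
    12 * k * 2 ^ k ≤ ε * Real.sqrt (Real.logb 2 n) * Real.logb 2 (Real.logb 2 n) := by
  have h := le_logb_of_pow_le hk hn
  have hk' : (1 : ℝ) ≤ k := by exact_mod_cast hk
  have h1 : 12 * (2 ^ k : ℝ) ≤ ε * Real.sqrt (Real.logb 2 n) := by
    rw [← div_le_iff₀' hε]
    apply Real.le_sqrt_of_sq_le
    refine le_trans ?_ h
    have h2 : 144 / ε ^ 2 ≤ k / 2 := by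
      rw [show 144 / ε ^ 2 = 288 / ε ^ 2 / 2 by ring]
      linarith
    calc (12 * (2 : ℝ) ^ k / ε) ^ 2 = (2 ^ k) ^ 2 * (144 / ε ^ 2) := by ring
      _ ≤ _ := by gcongr
  have h2 : (k : ℝ) ≤ Real.logb 2 (Real.logb 2 n) := by
    have h5 : (2 : ℝ) ≤ 2 ^ k := by exact_mod_cast Nat.le_self_pow (by omega) 2
    have h6 : (2 : ℝ) ^ (k : ℝ) ≤ Real.logb 2 n := by
      rw [Real.rpow_natCast]
      refine le_trans ?_ h
      nlinarith [mul_nonneg (show (0 : ℝ) ≤ 2 ^ k by positivity)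
        (show (0 : ℝ) ≤ 2 ^ k * k - 2 by nlinarith)]
    rwa [Real.le_logb_iff_rpow_le one_lt_two (lt_of_lt_of_le (by positivity) h6)]
  calc 12 * (k : ℝ) * 2 ^ k = 12 * 2 ^ k * k := by ring
    _ ≤ _ := mul_le_mul h1 h2 (by positivity) (le_trans (by positivity) h1)

theorem mainTheorem1 (ε : ℝ) (hε : 0 < ε) :
    ∃ H : (n : ℕ) → SimpleGraph (Fin n),
      PolyTimeOutputsAdjMatrix H ∧
      ∃ N : ℕ, ∀ n : ℕ, N ≤ n → ∀ S : Finset (Fin n),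
        ((H n).IsClique (S : Set (Fin n)) ∨ (H n).IsIndepSet (S : Set (Fin n))) →
          (S.card : ℝ) <
            (2 : ℝ) ^ (ε * Real.sqrt (Real.logb 2 (n : ℝ)) * Real.logb 2 (Real.logb 2 (n : ℝ))) := by
  refine ⟨_, polyTimeOutputsAdjMatrix_digitGraph, ?_⟩
  obtain ⟨K, hK⟩ := exists_nat_ge (288 / ε ^ 2)
  -- This threshold forces `k ≥ K + 1`. In particular `k ≥ 1`, so the base `2 ^ k` was rejected and
  -- `n` is bounded below in terms of `k`.
  refine ⟨(2 ^ (K + 1)) ^ (2 ^ (K + 1) * 2 ^ (K + 1) - 1), fun n hn S hS => ?_⟩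
  obtain ⟨k, h1, h2, h3⟩ := digitBase_spec n
  have hKk := le_of_le_of_digitBase_eq hn h1
  have hcard : S.card ≤ (digitBase n ^ 3) ^ (digitBase n - 1) := by
    rcases hS with hS | hS
    · have hpos := digitBase_pos n
      change (digitGraph (digitBase n) n hpos).IsClique _ at hS
      generalize digitBase n = q at *
      subst h1
      exact card_le_of_isClique_digitGraph hS
    · exact card_le_of_isIndepSet_digitGraph _ h2.le hS
  have hexp : S.card < 2 ^ (12 * k * 2 ^ k) := by
    refine hcard.trans_lt ?_
    rw [h1, ← pow_mul, ← pow_mul]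
    refine Nat.pow_lt_pow_right one_lt_two ?_
    have h4 : 1 ≤ 2 ^ (k + 1) := Nat.one_le_two_pow
    rw [← mul_assoc]
    -- Strictness comes from the exponent `q - 1` in place of `q`; the last step, `6 * k + 6 ≤ 12 *
    -- k`, needs `k ≥ 1`.
    calc (k + 1) * 3 * (2 ^ (k + 1) - 1) < (k + 1) * 3 * 2 ^ (k + 1) :=
          Nat.mul_lt_mul_of_pos_left (by omega) (by omega)
      _ = (6 * k + 6) * 2 ^ k := by ring
      _ ≤ 12 * k * 2 ^ k := Nat.mul_le_mul_right _ (by omega)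
  calc (S.card : ℝ) < 2 ^ (12 * k * 2 ^ k) := by exact_mod_cast hexp
    _ = 2 ^ (12 * k * 2 ^ k : ℝ) := by
        rw [← Real.rpow_natCast]
        push_cast
        rfl
    _ ≤ _ := Real.rpow_le_rpow_of_exponent_le one_le_two
        (lt_mul_sqrt_logb_mul_logb_logb hε (by omega)
          (hK.trans (by exact_mod_cast (by omega : K ≤ k))) (h3.resolve_left (by omega)))
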